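/- A lattice of rank $n$ is a subgroup $L=\mathbb{Z}e_1\oplus\cdots\oplus\mathbb{Z}e_n$ of Euclidean space $\mathbb{R}^n$, where $e_1,\ldots,e_n$ is a basis of $\mathbb{R}^n$. It is integral if $(x,y)\in\mathbb{Z}$ for all $x,y\in L$, where $(\cdot,\cdot)$ is the standard inner product. Two lattices in $\mathbb{R}^n$ are isomorphic if an orthogonal transformation of $\mathbb{R}^n$ maps one onto the other. The theta series of an integral lattice $L$ is the function $$\theta_L(z)=\sum_{x\in L}e^{\pi i z(x,x)}$$ on the upper half-plane $\{z\in\mathbb{C}\mid \operatorname{Im} z>0\}$. Theorem. Let $d\in\{24,27,30,33,35,36,38,39,41,42\}\cup\{i\in\mathbb{Z}\mid i\ge 44\}$. Then there exist two non-isomorphic integral lattices of rank $4d$ with the same theta series. -/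

import Mathlib

open scoped UpperHalfPlane

/-- A lattice in `ℝⁿ`: the set of integer combinations of some basis `e₁, …, eₙ` of the real
vector space `ℝⁿ`. Such a lattice has rank `n`. -/
def IsEuclideanLattice {n : ℕ} (L : Submodule ℤ (EuclideanSpace ℝ (Fin n))) : Prop :=
  ∃ e : Module.Basis (Fin n) ℝ (EuclideanSpace ℝ (Fin n)), L = Submodule.span ℤ (Set.range e)

/-- `L` is integral: all inner products of its vectors are integers. -/
def IsIntegralLattice {n : ℕ} (L : Submodule ℤ (EuclideanSpace ℝ (Fin n))) : Prop :=
  ∀ x ∈ L, ∀ y ∈ L, ∃ k : ℤ, inner ℝ x y = (k : ℝ)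

/-- Two lattices in `ℝⁿ` are isomorphic (isometric): an orthogonal transformation of `ℝⁿ`
carries one onto the other. -/
def LatticeIsomorphic {n : ℕ} (L₁ L₂ : Submodule ℤ (EuclideanSpace ℝ (Fin n))) : Prop :=
  ∃ f : EuclideanSpace ℝ (Fin n) ≃ₗᵢ[ℝ] EuclideanSpace ℝ (Fin n),
    f '' (L₁ : Set (EuclideanSpace ℝ (Fin n))) = (L₂ : Set (EuclideanSpace ℝ (Fin n)))

/-- The theta series of `L` as a function on the upper half-plane,
`θ_L(z) = ∑_{x ∈ L} exp(π i z (x, x))`. -/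
noncomputable def latticeTheta {n : ℕ} (L : Submodule ℤ (EuclideanSpace ℝ (Fin n))) (z : ℍ) : ℂ :=
  ∑' x : L, Complex.exp (Real.pi * Complex.I * z *
    ((inner ℝ (x : EuclideanSpace ℝ (Fin n)) (x : EuclideanSpace ℝ (Fin n)) : ℝ) : ℂ))

/-- For a lattice the series that defines `latticeTheta` converges absolutely, so that the
infinite sum there is a genuine one. -/
theorem summable_latticeTheta {n : ℕ} {L : Submodule ℤ (EuclideanSpace ℝ (Fin n))}
    (hL : IsEuclideanLattice L) (z : ℍ) :
    Summable fun x : L => Complex.exp (Real.pi * Complex.I * z *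
      ((inner ℝ (x : EuclideanSpace ℝ (Fin n)) (x : EuclideanSpace ℝ (Fin n)) : ℝ) : ℂ)) := by
  obtain ⟨e, rfl⟩ := hL
  set L := Submodule.span ℤ (Set.range e)
  have hs : Summable fun x : L => ‖x‖⁻¹ ^ (2 * (n + 1)) := by
    refine ZLattice.summable_norm_pow_inv _ _ ?_
    rw [ZLattice.rank ℝ L, finrank_euclideanSpace_fin]
    omega
  have hc : 0 < Real.pi * z.im := mul_pos Real.pi_pos z.im_pos
  refine Summable.of_norm_bounded_eventually
    (hs.mul_left (((n + 1).factorial : ℝ) * ((Real.pi * z.im) ^ (n + 1))⁻¹)) ?_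
  filter_upwards [(Set.finite_singleton (0 : L)).compl_mem_cofinite] with x hx
  have hx0 : 0 < ‖x‖ := norm_pos_iff.mpr hx
  have hnorm : ‖Complex.exp (Real.pi * Complex.I * z *
      ((inner ℝ (x : EuclideanSpace ℝ (Fin n)) (x : EuclideanSpace ℝ (Fin n)) : ℝ) : ℂ))‖ =
      (Real.exp (Real.pi * z.im * ‖x‖ ^ 2))⁻¹ := by
    rw [Complex.norm_exp, ← Real.exp_neg, real_inner_self_eq_norm_sq]
    congr 1
    simp [Complex.mul_re, Complex.mul_im, -Complex.ofReal_pow]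
  rw [hnorm]
  have h := Real.pow_div_factorial_le_exp (Real.pi * z.im * ‖x‖ ^ 2) (by positivity) (n + 1)
  calc (Real.exp (Real.pi * z.im * ‖x‖ ^ 2))⁻¹
      ≤ ((Real.pi * z.im * ‖x‖ ^ 2) ^ (n + 1) / ((n + 1).factorial : ℝ))⁻¹ :=
        inv_anti₀ (by positivity) h
    _ = _ := by rw [inv_div, mul_pow, ← pow_mul, inv_pow, div_eq_mul_inv, mul_inv, mul_assoc]

/-! Lift binary codes of length 6 to integer lattices. The code spanned by `110000`, `001100`,
`000011` and the one spanned by `110000`, `101000`, `111111` both have weight enumerator `1 + 3y² +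
3y⁴ + y⁶`, so their lifts have equal theta series (`pairEquivTriple`). Only the first code is
self-orthogonal, so only its lift has all inner products even (`two_dvd_inner_pairLattice`). Adding
`(2ℤ)ᵐ`, whose inner products are divisible by 4, keeps both facts and reaches every rank `6 + m`.
-/

/-- The embedding of `ℤ⁶ ⊕ ℤᵐ` into `ℝ⁶⁺ᵐ` that scales the second summand by `2`. -/
noncomputable def scaledEmbedding (m : ℕ) :
    ((Fin 6 → ℤ) × (Fin m → ℤ)) →ₗ[ℤ] EuclideanSpace ℝ (Fin (6 + m)) where
  toFun p := WithLp.toLp 2 fun i => ((Fin.append p.1 (2 • p.2) i : ℤ) : ℝ)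
  map_add' p q := by
    ext i
    induction i using Fin.addCases <;> simp
  map_smul' c p := by
    ext i
    induction i using Fin.addCases <;> simp [mul_left_comm]

theorem scaledEmbedding_apply_castAdd {m : ℕ} (p : (Fin 6 → ℤ) × (Fin m → ℤ)) (j : Fin 6) :
    scaledEmbedding m p (Fin.castAdd m j) = p.1 j := by
  simp [scaledEmbedding]

theorem scaledEmbedding_apply_natAdd {m : ℕ} (p : (Fin 6 → ℤ) × (Fin m → ℤ)) (j : Fin m) :
    scaledEmbedding m p (Fin.natAdd 6 j) = 2 * p.2 j := by
  simp [scaledEmbedding]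

theorem inner_scaledEmbedding {m : ℕ} (p q : (Fin 6 → ℤ) × (Fin m → ℤ)) :
    inner ℝ (scaledEmbedding m p) (scaledEmbedding m q) =
      ((∑ j, p.1 j * q.1 j + 4 * ∑ j, p.2 j * q.2 j : ℤ) : ℝ) := by
  rw [PiLp.inner_apply, Fin.sum_univ_add]
  simp only [scaledEmbedding_apply_castAdd, scaledEmbedding_apply_natAdd, RCLike.inner_apply,
    conj_trivial]
  push_cast
  rw [Finset.mul_sum]
  congr 1 <;> refine Finset.sum_congr rfl fun j _ => by ring

theorem scaledEmbedding_injective (m : ℕ) : Function.Injective (scaledEmbedding m) := by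
  intro p q h
  refine Prod.ext (funext fun j => ?_) (funext fun j => ?_)
  · have := congrArg (fun v => v (Fin.castAdd m j)) h
    simpa [scaledEmbedding_apply_castAdd] using this
  · have := congrArg (fun v => v (Fin.natAdd 6 j)) h
    simpa [scaledEmbedding_apply_natAdd] using this

/-- The lattice `C ⊕ (2ℤ)ᵐ` in `ℝ⁶⁺ᵐ` attached to a subgroup `C` of `ℤ⁶`. -/
noncomputable def extendedLattice (m : ℕ) (C : Submodule ℤ (Fin 6 → ℤ)) :
    Submodule ℤ (EuclideanSpace ℝ (Fin (6 + m))) :=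
  (C.prod ⊤).map (scaledEmbedding m)

theorem scaledEmbedding_mem_extendedLattice {m : ℕ} {C : Submodule ℤ (Fin 6 → ℤ)} {x : Fin 6 → ℤ}
    (hx : x ∈ C) (y : Fin m → ℤ) : scaledEmbedding m (x, y) ∈ extendedLattice m C :=
  Submodule.mem_map_of_mem ⟨hx, trivial⟩

theorem isIntegralLattice_extendedLattice (m : ℕ) (C : Submodule ℤ (Fin 6 → ℤ)) :
    IsIntegralLattice (extendedLattice m C) := by
  rintro _ ⟨p, -, rfl⟩ _ ⟨q, -, rfl⟩
  exact ⟨_, inner_scaledEmbedding p q⟩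

/-- A discrete subgroup that spans `ℝⁿ` is a lattice. -/
theorem isEuclideanLattice_of_isZLattice {n : ℕ} (L : Submodule ℤ (EuclideanSpace ℝ (Fin n)))
    [DiscreteTopology L] [IsZLattice ℝ L] : IsEuclideanLattice L := by
  have : Module.Free ℤ L := ZLattice.module_free ℝ L
  have : Module.Finite ℤ L := ZLattice.module_finite ℝ L
  have hr : Module.finrank ℤ L = n := by
    rw [ZLattice.rank ℝ L, finrank_euclideanSpace_fin]
  let b : Module.Basis (Fin n) ℤ L := Module.finBasisOfFinrankEq ℤ L hr
  exact ⟨b.ofZLatticeBasis ℝ L, (b.ofZLatticeBasis_span ℝ L).symm⟩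

/-- The group lies between `2ℤⁿ` and `ℤⁿ`, where `n = 6 + m`: the upper bound gives discreteness,
the lower one gives full rank. -/
theorem isEuclideanLattice_extendedLattice (m : ℕ) {C : Submodule ℤ (Fin 6 → ℤ)}
    (hC : ∀ x : Fin 6 → ℤ, 2 • x ∈ C) : IsEuclideanLattice (extendedLattice m C) := by
  let e := (EuclideanSpace.basisFun (Fin (6 + m)) ℝ).toBasis
  have hle : extendedLattice m C ≤ Submodule.span ℤ (Set.range e) := by
    rintro _ ⟨p, -, rfl⟩
    rw [Module.Basis.mem_span_iff_repr_mem]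
    intro i
    exact ⟨Fin.append p.1 (2 • p.2) i, by simp [e, scaledEmbedding]⟩
  have hd : DiscreteTopology (Submodule.span ℤ (Set.range e)) := inferInstance
  have : DiscreteTopology (extendedLattice m C) :=
    DiscreteTopology.of_subset hd hle
  have hspan :
      Submodule.span ℝ (extendedLattice m C : Set (EuclideanSpace ℝ (Fin (6 + m)))) = ⊤ := by
    rw [eq_top_iff, ← e.span_eq, Submodule.span_le]
    rintro _ ⟨i, rfl⟩
    have h : (2 : ℝ) • e i ∈ extendedLattice m C := by
      let w : Fin (6 + m) → ℤ := Pi.single i 1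
      convert scaledEmbedding_mem_extendedLattice (hC fun j => w (Fin.castAdd m j))
        fun j => w (Fin.natAdd 6 j) using 1
      ext k
      induction k using Fin.addCases <;>
        simp [e, w, scaledEmbedding_apply_castAdd, scaledEmbedding_apply_natAdd, Pi.single_apply]
    have h' := Submodule.smul_mem _ (2⁻¹ : ℝ) (Submodule.subset_span (R := ℝ) h)
    rwa [smul_smul, inv_mul_cancel₀ two_ne_zero, one_smul] at h'
  have : IsZLattice ℝ (extendedLattice m C) := ⟨hspan⟩
  exact isEuclideanLattice_of_isZLattice _

theorem latticeTheta_extendedLattice (m : ℕ) (C : Submodule ℤ (Fin 6 → ℤ)) (z : UpperHalfPlane) :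
    latticeTheta (extendedLattice m C) z =
      ∑' p : C × (Fin m → ℤ), Complex.exp (Real.pi * Complex.I * z *
        ((∑ j, p.1.1 j ^ 2 + 4 * ∑ j, p.2 j ^ 2 : ℤ) : ℂ)) := by
  let g : C × (Fin m → ℤ) → extendedLattice m C := fun p =>
    ⟨scaledEmbedding m (p.1.1, p.2), scaledEmbedding_mem_extendedLattice p.1.2 p.2⟩
  have hg : Function.Bijective g := by
    constructor
    · intro p q h
      have := scaledEmbedding_injective m (congrArg Subtype.val h)
      rw [Prod.mk.injEq] at this
      exact Prod.ext (Subtype.ext this.1) this.2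
    · rintro ⟨_, p, hp, rfl⟩
      exact ⟨(⟨p.1, hp.1⟩, p.2), rfl⟩
  rw [latticeTheta, ← (Equiv.ofBijective g hg).tsum_eq]
  refine tsum_congr fun p => ?_
  rw [Equiv.ofBijective_apply, inner_scaledEmbedding, Complex.ofReal_intCast]
  simp only [pow_two]

/-- Norm-preserving bijections of the first summands preserve theta series. -/
theorem latticeTheta_extendedLattice_congr (m : ℕ) {C D : Submodule ℤ (Fin 6 → ℤ)} (f : C ≃ D)
    (hf : ∀ x : C, ∑ j, (f x).1 j ^ 2 = ∑ j, x.1 j ^ 2) :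
    latticeTheta (extendedLattice m C) = latticeTheta (extendedLattice m D) := by
  funext z
  rw [latticeTheta_extendedLattice, latticeTheta_extendedLattice,
    ← (f.prodCongr (Equiv.refl (Fin m → ℤ))).tsum_eq]
  refine tsum_congr fun p => ?_
  simp only [Equiv.prodCongr_apply, Prod.map, Equiv.refl_apply, hf]

/-- Integer vectors whose reduction modulo `2` lies in the code spanned by
`110000`, `001100`, `000011`. -/
def pairLattice : Submodule ℤ (Fin 6 → ℤ) where
  carrier := {x | 2 ∣ x 0 - x 1 ∧ 2 ∣ x 2 - x 3 ∧ 2 ∣ x 4 - x 5}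
  add_mem' := by
    rintro x y ⟨h₁, h₂, h₃⟩ ⟨k₁, k₂, k₃⟩
    refine ⟨?_, ?_, ?_⟩ <;> simp only [Pi.add_apply] <;> omega
  zero_mem' := by simp
  smul_mem' := by
    rintro c x ⟨h₁, h₂, h₃⟩
    refine ⟨?_, ?_, ?_⟩ <;> simp only [Pi.smul_apply, smul_eq_mul, ← mul_sub] <;>
      exact Dvd.dvd.mul_left (by assumption) c

/-- Integer vectors whose reduction modulo `2` lies in the code spanned by
`110000`, `101000`, `111111`. -/
def tripleLattice : Submodule ℤ (Fin 6 → ℤ) where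
  carrier := {x | 2 ∣ x 3 - x 4 ∧ 2 ∣ x 4 - x 5 ∧ 2 ∣ x 0 + x 1 + x 2 - x 3}
  add_mem' := by
    rintro x y ⟨h₁, h₂, h₃⟩ ⟨k₁, k₂, k₃⟩
    refine ⟨?_, ?_, ?_⟩ <;> simp only [Pi.add_apply] <;> omega
  zero_mem' := by simp
  smul_mem' := by
    rintro c x ⟨h₁, h₂, h₃⟩
    refine ⟨?_, ?_, ?_⟩ <;> simp only [Pi.smul_apply, smul_eq_mul, ← mul_sub, ← mul_add] <;>
      exact Dvd.dvd.mul_left (by assumption) c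

theorem mem_pairLattice {x : Fin 6 → ℤ} :
    x ∈ pairLattice ↔ 2 ∣ x 0 - x 1 ∧ 2 ∣ x 2 - x 3 ∧ 2 ∣ x 4 - x 5 := Iff.rfl

theorem mem_tripleLattice {x : Fin 6 → ℤ} :
    x ∈ tripleLattice ↔ 2 ∣ x 3 - x 4 ∧ 2 ∣ x 4 - x 5 ∧ 2 ∣ x 0 + x 1 + x 2 - x 3 := Iff.rfl

/-- On each coset of `2ℤ⁶` a permutation of the coordinates, chosen so that the code of
`pairLattice` is carried to that of `tripleLattice`. -/
def pairToTriple (x : Fin 6 → ℤ) : Fin 6 → ℤ :=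
  -- Modulo 2, `x` is `aabbcc`, and two of the bits agree. The cases `b = c`, `a = c ≠ b`, `a = b ≠
  -- c` give `aabbbb`, `babaaa`, `accaaa`, all in the second code.
  if 2 ∣ x 2 - x 4 then x
  else if 2 ∣ x 0 - x 4 then ![x 3, x 1, x 2, x 0, x 4, x 5]
  else ![x 0, x 4, x 5, x 3, x 1, x 2]

/-- The inverse of `pairToTriple`. -/
def tripleToPair (x : Fin 6 → ℤ) : Fin 6 → ℤ :=
  -- The leading bits `aab`, `bab`, `acc` of the image reveal which permutation was used, and each
  -- is an involution.
  if 2 ∣ x 0 - x 1 then x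
  else if 2 ∣ x 0 - x 2 then ![x 3, x 1, x 2, x 0, x 4, x 5]
  else ![x 0, x 4, x 5, x 3, x 1, x 2]

theorem pairToTriple_mem {x : Fin 6 → ℤ} (hx : x ∈ pairLattice) :
    pairToTriple x ∈ tripleLattice := by
  rw [mem_pairLattice] at hx
  rw [mem_tripleLattice, pairToTriple]
  split_ifs
  · omega
  · simp; omega
  · simp; omega

theorem tripleToPair_mem {x : Fin 6 → ℤ} (hx : x ∈ tripleLattice) :
    tripleToPair x ∈ pairLattice := by
  rw [mem_tripleLattice] at hx
  rw [mem_pairLattice, tripleToPair]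
  split_ifs
  · omega
  · simp; omega
  · simp; omega

theorem tripleToPair_pairToTriple {x : Fin 6 → ℤ} (hx : x ∈ pairLattice) :
    tripleToPair (pairToTriple x) = x := by
  rw [mem_pairLattice] at hx
  rw [pairToTriple]
  split_ifs
  · rw [tripleToPair, if_pos (by omega)]
  · rw [tripleToPair, if_neg (by simp; omega), if_pos (by simp; omega)]
    ext j; fin_cases j <;> rfl
  · rw [tripleToPair, if_neg (by simp; omega), if_neg (by simp; omega)]
    ext j; fin_cases j <;> rfl

theorem pairToTriple_tripleToPair {x : Fin 6 → ℤ} (hx : x ∈ tripleLattice) :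
    pairToTriple (tripleToPair x) = x := by
  rw [mem_tripleLattice] at hx
  rw [tripleToPair]
  split_ifs
  · rw [pairToTriple, if_pos (by omega)]
  · rw [pairToTriple, if_neg (by simp; omega), if_pos (by simp; omega)]
    ext j; fin_cases j <;> rfl
  · rw [pairToTriple, if_neg (by simp; omega), if_neg (by simp; omega)]
    ext j; fin_cases j <;> rfl

theorem sum_sq_pairToTriple (x : Fin 6 → ℤ) : ∑ j, pairToTriple x j ^ 2 = ∑ j, x j ^ 2 := by
  rw [pairToTriple]
  split_ifs <;> simp [Fin.sum_univ_six] <;> ring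

/-- The norm-preserving bijection between `pairLattice` and `tripleLattice`. -/
def pairEquivTriple : pairLattice ≃ tripleLattice where
  toFun x := ⟨pairToTriple x.1, pairToTriple_mem x.2⟩
  invFun x := ⟨tripleToPair x.1, tripleToPair_mem x.2⟩
  left_inv x := Subtype.ext (tripleToPair_pairToTriple x.2)
  right_inv x := Subtype.ext (pairToTriple_tripleToPair x.2)

/-- `pairLattice ≅ √2 ℤ⁶`, so all its inner products are even. -/
theorem two_dvd_inner_pairLattice {x y : Fin 6 → ℤ} (hx : x ∈ pairLattice)
    (hy : y ∈ pairLattice) : 2 ∣ ∑ j, x j * y j := by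
  obtain ⟨⟨a, ha⟩, ⟨b, hb⟩, ⟨c, hc⟩⟩ := mem_pairLattice.1 hx
  obtain ⟨⟨a', ha'⟩, ⟨b', hb'⟩, ⟨c', hc'⟩⟩ := mem_pairLattice.1 hy
  rw [sub_eq_iff_eq_add] at ha hb hc ha' hb' hc'
  rw [Fin.sum_univ_six, ha, hb, hc, ha', hb', hc']
  -- Per pair of coordinates: `(2a + u)(2a' + v) + uv = 2(2aa' + av + ua' + uv)`.
  exact ⟨2 * a * a' + a * y 1 + x 1 * a' + x 1 * y 1 + (2 * b * b' + b * y 3 + x 3 * b' + x 3 * y 3)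
    + (2 * c * c' + c * y 5 + x 5 * c' + x 5 * y 5), by ring⟩

theorem not_latticeIsomorphic_pairLattice_tripleLattice (m : ℕ) :
    ¬ LatticeIsomorphic (extendedLattice m pairLattice) (extendedLattice m tripleLattice) := by
  rintro ⟨f, hf⟩
  -- An isometry would carry evenness of all inner products to the second lattice.
  have key : ∀ x ∈ extendedLattice m tripleLattice, ∀ y ∈ extendedLattice m tripleLattice,
      ∃ k : ℤ, inner ℝ x y = ((2 * k : ℤ) : ℝ) := by
    intro x hx y hy
    rw [← SetLike.mem_coe, ← hf] at hx hy
    obtain ⟨_, ⟨p, hp, rfl⟩, rfl⟩ := hx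
    obtain ⟨_, ⟨q, hq, rfl⟩, rfl⟩ := hy
    obtain ⟨k, hk⟩ := two_dvd_inner_pairLattice hp.1 hq.1
    refine ⟨k + 2 * ∑ j, p.2 j * q.2 j, ?_⟩
    rw [f.inner_map_map, inner_scaledEmbedding, hk]
    congr 1
    ring
  -- The codewords `110000` and `101000` overlap in one place, so their inner product is 1.
  obtain ⟨k, hk⟩ := key
    _ (scaledEmbedding_mem_extendedLattice (x := ![1, 1, 0, 0, 0, 0])
      (by simp [mem_tripleLattice]) 0)
    _ (scaledEmbedding_mem_extendedLattice (x := ![1, 0, 1, 0, 0, 0])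
      (by simp [mem_tripleLattice]) 0)
  rw [inner_scaledEmbedding, Int.cast_inj] at hk
  simp [Fin.sum_univ_six] at hk
  omega

/-- In every dimension at least `6` there are two non-isomorphic integral lattices with the same
theta series. -/
theorem exists_not_latticeIsomorphic_latticeTheta_eq {n : ℕ} (hn : 6 ≤ n) :
    ∃ L₁ L₂ : Submodule ℤ (EuclideanSpace ℝ (Fin n)),
      IsEuclideanLattice L₁ ∧ IsEuclideanLattice L₂ ∧
      IsIntegralLattice L₁ ∧ IsIntegralLattice L₂ ∧
      ¬ LatticeIsomorphic L₁ L₂ ∧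
      latticeTheta L₁ = latticeTheta L₂ := by
  obtain ⟨m, rfl⟩ := Nat.exists_eq_add_of_le hn
  refine ⟨extendedLattice m pairLattice, extendedLattice m tripleLattice,
    isEuclideanLattice_extendedLattice m fun x => ?_,
    isEuclideanLattice_extendedLattice m fun x => ?_,
    isIntegralLattice_extendedLattice m _, isIntegralLattice_extendedLattice m _,
    not_latticeIsomorphic_pairLattice_tripleLattice m,
    latticeTheta_extendedLattice_congr m pairEquivTriple fun x => sum_sq_pairToTriple x.1⟩
  · rw [mem_pairLattice]
    simp only [Pi.smul_apply, nsmul_eq_mul, Nat.cast_ofNat]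
    omega
  · rw [mem_tripleLattice]
    simp only [Pi.smul_apply, nsmul_eq_mul, Nat.cast_ofNat]
    omega

theorem theorem1p7 (d : ℕ)
    (hd : d ∈ ({24, 27, 30, 33, 35, 36, 38, 39, 41, 42} : Set ℕ) ∪ {i : ℕ | 44 ≤ i}) :
    ∃ L₁ L₂ : Submodule ℤ (EuclideanSpace ℝ (Fin (4 * d))),
      IsEuclideanLattice L₁ ∧ IsEuclideanLattice L₂ ∧
      IsIntegralLattice L₁ ∧ IsIntegralLattice L₂ ∧
      ¬ LatticeIsomorphic L₁ L₂ ∧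
      latticeTheta L₁ = latticeTheta L₂ := by
  refine exists_not_latticeIsomorphic_latticeTheta_eq ?_
  simp only [Set.mem_union, Set.mem_insert_iff, Set.mem_singleton_iff, Set.mem_ofPred_eq] at hd
  omega
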